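/- Let $E=(E^0,E^1,r,s)$ be a directed graph (loops and multiple edges allowed, $E^1$ possibly infinite) with a finite nonempty vertex set $E^0$. Assume that $E$ has no sinks (every vertex is the source $s(e)$ of some edge $e$), has no sources (every vertex is the range $r(e)$ of some edge $e$), and is weakly connected (for all $v,w\in E^0$ there is a finite sequence of vertices $v=v_1,\dots,v_n=w$ such that for each $1\le i<n$ there is an edge from $v_i$ to $v_{i+1}$ or an edge from $v_{i+1}$ to $v_i$). Let $A=C_0(E^0)$, where $E^0$ is discrete, and let $X(E)$ be the graph correspondence, i.e. the $C^*$-correspondence over $A$ $$X(E)=\Big\{\xi:E^1\to\mathbb C \;:\; v\mapsto \sum_{r(e)=v}|\xi(e)|^2 \text{ is in } C_0(E^0)\Big\}$$ with $(a\cdot\xi)(e)=a(s(e))\xi(e)$, $(\xi\cdot a)(e)=\xi(e)a(r(e))$ and $\langle\xi,\eta\rangle(v)=\sum_{r(e)=v}\overline{\xi(e)}\,\eta(e)$. Let $X(E)^{\otimes 0}=A$ be the identity correspondence (left and right multiplication, $\langle a,b\rangle=a^*b$), and for $n\ge 1$ let $X(E)^{\otimes n}$ be the $n$-fold (completed) $A$-balanced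 tensor product of $X(E)$ with itself. An isomorphism of $C^*$-correspondences over $A$ is a bijection that preserves the left action and the $A$-valued inner product. Call $X(E)$ nonperiodic if for every integer $n\ge 0$, $X(E)^{\otimes n}\cong A$ as $C^*$-correspondences implies $n=0$. Then the following are equivalent: 1. $X(E)$ is nonperiodic. 2. $E$ is not a simple cycle; that is, there are no $k\ge1$ and enumerations without repetition $E^0=\{v_1,\dots,v_k\}$, $E^1=\{e_1,\dots,e_k\}$ such that $s(e_i)=v_i$ and $r(e_i)=v_{i+1}$ for all $i$, with $v_{k+1}=v_1$. -/

import Mathlib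

open scoped TensorProduct ZeroAtInfty

/-- An element of a C*-algebra is positive when it is of the form `b* b`. -/
def IsPositiveElement {A : Type*} [NonUnitalCStarAlgebra A] (a : A) : Prop :=
  ∃ b : A, a = star b * b

/-- The data of a (possibly degenerate, possibly incomplete) C*-correspondence on a complex vector
space `X`: an `A`-valued inner product, conjugate linear in the first variable and possibly with
null vectors, a right action `right a x = x · a`, and a left action `left a x = a · x` of `A` by
operators with adjoints `(left a)* = left a*`. -/
structure SemiCorrespondence (A X : Type*) [NonUnitalCStarAlgebra A] [AddCommGroup X]
    [Module ℂ X] where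
  inner : X →ₗ⋆[ℂ] X →ₗ[ℂ] A
  right : A →ₗ[ℂ] X →ₗ[ℂ] X
  left : A →ₗ[ℂ] X →ₗ[ℂ] X
  star_inner : ∀ x y, star (inner x y) = inner y x
  inner_self_pos : ∀ x, IsPositiveElement (inner x x)
  inner_right : ∀ x y a, inner x (right a y) = inner x y * a
  right_mul : ∀ a b x, right (a * b) x = right b (right a x)
  left_mul : ∀ a b x, left (a * b) x = left a (left b x)
  inner_left : ∀ a x y, inner (left a x) y = inner x (left (star a) y)

/-- A C*-correspondence over `A`: a right Hilbert `A`-module, complete in the norm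
`‖x‖ = ‖⟨x, x⟩‖ ^ (1 / 2)`, with a left action of `A` by a `*`-homomorphism into the adjointable
operators. (Adjointable operators on a Hilbert module are automatically bounded and right
`A`-linear.) -/
structure CStarCorrespondence.{u} (A : Type u) [NonUnitalCStarAlgebra A] where
  carrier : Type u
  [normedAddCommGroup : NormedAddCommGroup carrier]
  [normedSpace : NormedSpace ℂ carrier]
  [completeSpace : CompleteSpace carrier]
  str : SemiCorrespondence A carrier
  norm_sq : ∀ x : carrier, ‖x‖ ^ 2 = ‖str.inner x x‖

attribute [instance] CStarCorrespondence.normedAddCommGroup CStarCorrespondence.normedSpace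
  CStarCorrespondence.completeSpace

section Positivity

variable {A : Type*} [NonUnitalCStarAlgebra A]

theorem isPositiveElement_iff_nonneg [PartialOrder A] [StarOrderedRing A] (a : A) :
    IsPositiveElement a ↔ 0 ≤ a :=
  CStarAlgebra.nonneg_iff_eq_star_mul_self.symm

theorem IsPositiveElement.sum {ι : Type*} (s : Finset ι) (f : ι → A)
    (h : ∀ i ∈ s, IsPositiveElement (f i)) : IsPositiveElement (∑ i ∈ s, f i) := by
  let _ : PartialOrder A := CStarAlgebra.spectralOrder A
  have _ : StarOrderedRing A := CStarAlgebra.spectralOrderedRing A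
  rw [isPositiveElement_iff_nonneg]
  exact Finset.sum_nonneg fun i hi => (isPositiveElement_iff_nonneg _).1 (h i hi)

/-- The negative part `N` of a self-adjoint element `m`, with a factorization. -/
theorem exists_negPart (m : A) (hm : star m = m) : ∃ N K : A, star N = N ∧ N = star K * K ∧
    m * N = -(N * N) ∧ (N = 0 → ∃ b : A, m = star b * b) := by
  let _ : PartialOrder A := CStarAlgebra.spectralOrder A
  have _ : StarOrderedRing A := CStarAlgebra.spectralOrderedRing A
  have hN0 : 0 ≤ m⁻ := CFC.negPart_nonneg m
  have hMsub : m⁺ - m⁻ = m := CFC.posPart_sub_negPart m hm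
  have hPN : m⁺ * m⁻ = 0 := CFC.posPart_mul_negPart m
  obtain ⟨K, hK⟩ := CStarAlgebra.nonneg_iff_eq_star_mul_self.1 hN0
  refine ⟨m⁻, K, IsSelfAdjoint.of_nonneg hN0, hK, ?_, fun hN => ?_⟩
  · conv_lhs => lhs; rw [← hMsub]
    rw [sub_mul, hPN, zero_sub]
  · refine CStarAlgebra.nonneg_iff_eq_star_mul_self.1 ?_
    rw [← hMsub, hN, sub_zero]
    exact CFC.posPart_nonneg m

/-- A self-adjoint matrix over a C*-algebra whose quadratic form is positive is of the form
`B* B`. -/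
theorem exists_matrix_factor {n : Type*} [Fintype n] (M : CStarMatrix n n A)
    (hM : star M = M)
    (hpos : ∀ v : n → A, IsPositiveElement (∑ i, ∑ j, star (v i) * M i j * v j)) :
    ∃ B : CStarMatrix n n A, M = star B * B := by
  let _ : PartialOrder A := CStarAlgebra.spectralOrder A
  have _ : StarOrderedRing A := CStarAlgebra.spectralOrderedRing A
  obtain ⟨N, K, hNs, hK, hMN, hconcl⟩ := exists_negPart M hM
  have hsum : star N * (M * N) + star (K * N) * (K * N) = 0 := by
    rw [hMN, star_mul, hNs]
    have : N * star K * (K * N) = N * (star K * K) * N := by simp only [mul_assoc]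
    rw [this, ← hK]
    simp [mul_assoc]
  have hR : K * N = 0 := by
    refine CStarMatrix.ext fun i k => ?_
    have h1 : (star N * (M * N)) k k = ∑ i, ∑ j, star (N i k) * M i j * N j k := by
      simp [CStarMatrix.mul_apply, CStarMatrix.star_apply, Finset.mul_sum, mul_assoc]
    have h2 : (star (K * N) * (K * N)) k k
        = ∑ i, star ((K * N) i k) * (K * N) i k := by
      rw [CStarMatrix.mul_apply]
      simp [CStarMatrix.star_apply]
    have h3 : (star N * (M * N)) k k + (star (K * N) * (K * N)) k k = 0 := by
      have := congrArg (fun Z : CStarMatrix n n A => Z k k) hsum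
      simpa using this
    have h4 : 0 ≤ (star N * (M * N)) k k := by
      rw [h1]; exact (isPositiveElement_iff_nonneg _).1 (hpos fun i => N i k)
    have h5 : ∀ i ∈ Finset.univ, 0 ≤ star ((K * N) i k) * (K * N) i k :=
      fun i _ => star_mul_self_nonneg _
    have h6 : ∑ i, star ((K * N) i k) * (K * N) i k = 0 := by
      rw [h2] at h3
      exact ((add_eq_zero_iff_of_nonneg h4 (Finset.sum_nonneg h5)).1 h3).2
    have h7 := (Finset.sum_eq_zero_iff_of_nonneg h5).1 h6 i (Finset.mem_univ i)
    simpa using CStarRing.star_mul_self_eq_zero_iff _ |>.1 h7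
  have hNN : N * N = 0 := by
    conv_lhs => lhs; rw [hK]
    rw [mul_assoc, hR, mul_zero]
  have hN : N = 0 := by
    have : star N * N = 0 := by rw [hNs, hNN]
    exact (CStarRing.star_mul_self_eq_zero_iff _).1 this
  exact hconcl hN

end Positivity

namespace SemiCorrespondence

variable {A X Y : Type*} [NonUnitalCStarAlgebra A] [AddCommGroup X] [Module ℂ X]
  [AddCommGroup Y] [Module ℂ Y]

theorem right_inner (P : SemiCorrespondence A X) (a : A) (x y : X) :
    P.inner (P.right a x) y = star a * P.inner x y := by
  rw [← P.star_inner, P.inner_right, star_mul, P.star_inner]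

/-- The Gram matrix of finitely many vectors is of the form `B* B`. -/
theorem exists_gram_factor (P : SemiCorrespondence A X) {n : Type*} [Fintype n] (x : n → X) :
    ∃ B : n → n → A, ∀ i j, P.inner (x i) (x j) = ∑ k, star (B k i) * B k j := by
  have hpos : ∀ v : n → A, IsPositiveElement
      (∑ i, ∑ j, star (v i) * P.inner (x i) (x j) * v j) := fun v => by
    have h : P.inner (∑ i, P.right (v i) (x i)) (∑ i, P.right (v i) (x i))
        = ∑ i, ∑ j, star (v i) * P.inner (x i) (x j) * v j := by
      simp only [map_sum, LinearMap.sum_apply, P.inner_right, P.right_inner]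
      exact Finset.sum_comm
    rw [← h]
    exact P.inner_self_pos _
  let M : CStarMatrix n n A := fun i j => P.inner (x i) (x j)
  have hM : star M = M := CStarMatrix.ext fun i j => P.star_inner _ _
  obtain ⟨B, hB⟩ := exists_matrix_factor M hM hpos
  refine ⟨B, fun i j => ?_⟩
  have h : M i j = (star B * B) i j := by rw [← hB]
  rw [CStarMatrix.mul_apply] at h
  exact h

/-- For fixed `x` and `y`, the linear functional `x' ⊗ y' ↦ ⟨y, ⟨x, x'⟩ · y'⟩`. -/
noncomputable def tensorInnerAux (P : SemiCorrespondence A X) (Q : SemiCorrespondence A Y)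
    (x : X) (y : Y) : X ⊗[ℂ] Y →ₗ[ℂ] A :=
  TensorProduct.lift ((Q.left ∘ₗ P.inner x).compr₂ (Q.inner y))

@[simp]
theorem tensorInnerAux_tmul (P : SemiCorrespondence A X) (Q : SemiCorrespondence A Y)
    (x x' : X) (y y' : Y) :
    tensorInnerAux P Q x y (x' ⊗ₜ y') = Q.inner y (Q.left (P.inner x x') y') :=
  rfl

/-- The `A`-valued inner product on the algebraic tensor product, determined by
`⟨x ⊗ y, x' ⊗ y'⟩ = ⟨y, ⟨x, x'⟩ · y'⟩`. -/
noncomputable def tensorInner (P : SemiCorrespondence A X) (Q : SemiCorrespondence A Y) :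
    X ⊗[ℂ] Y →ₗ⋆[ℂ] X ⊗[ℂ] Y →ₗ[ℂ] A :=
  TensorProduct.lift <|
    LinearMap.mk₂'ₛₗ (starRingEnd ℂ) (starRingEnd ℂ) (tensorInnerAux P Q)
      (fun _ _ _ => TensorProduct.ext' fun _ _ => by
        simp only [tensorInnerAux_tmul, map_add, LinearMap.add_apply])
      (fun _ _ _ => TensorProduct.ext' fun _ _ => by
        simp only [tensorInnerAux_tmul, map_smulₛₗ, LinearMap.smul_apply, RingHom.id_apply])
      (fun _ _ _ => TensorProduct.ext' fun _ _ => by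
        simp only [tensorInnerAux_tmul, map_add, LinearMap.add_apply])
      (fun _ _ _ => TensorProduct.ext' fun _ _ => by
        simp only [tensorInnerAux_tmul, map_smulₛₗ, LinearMap.smul_apply])

@[simp]
theorem tensorInner_tmul (P : SemiCorrespondence A X) (Q : SemiCorrespondence A Y)
    (x x' : X) (y y' : Y) :
    tensorInner P Q (x ⊗ₜ y) (x' ⊗ₜ y') = Q.inner y (Q.left (P.inner x x') y') :=
  rfl

/-- The algebraic tensor product over `ℂ` of two correspondences over `A`, with
`⟨x ⊗ y, x' ⊗ y'⟩ = ⟨y, ⟨x, x'⟩ · y'⟩`, `(x ⊗ y) · a = x ⊗ (y · a)` and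
`a · (x ⊗ y) = (a · x) ⊗ y`. The differences `(x · a) ⊗ y - x ⊗ (a · y)` are null vectors. -/
noncomputable def tensor (P : SemiCorrespondence A X) (Q : SemiCorrespondence A Y) :
    SemiCorrespondence A (X ⊗[ℂ] Y) where
  inner := tensorInner P Q
  right := LinearMap.lTensorHom X ∘ₗ Q.right
  left := LinearMap.rTensorHom Y ∘ₗ P.left
  star_inner z w := by
    induction z with
    | zero => simp
    | add z z' hz hz' => simp only [map_add, LinearMap.add_apply, star_add, hz, hz']
    | tmul x y =>
      induction w with
      | zero => simp
      | add w w' hw hw' => simp only [map_add, LinearMap.add_apply, star_add, hw, hw']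
      | tmul x' y' => simp only [tensorInner_tmul, Q.star_inner, Q.inner_left, P.star_inner]
  inner_self_pos z := by
    obtain ⟨S, rfl⟩ := TensorProduct.exists_finset z
    obtain ⟨B, hB⟩ := P.exists_gram_factor (fun i : S => i.1.1)
    have h : tensorInner P Q (∑ i ∈ S, i.1 ⊗ₜ i.2) (∑ i ∈ S, i.1 ⊗ₜ i.2)
        = ∑ k : S, Q.inner (∑ i : S, Q.left (B k i) i.1.2) (∑ i : S, Q.left (B k i) i.1.2) := by
      rw [← Finset.sum_coe_sort S]
      simp only [map_sum, LinearMap.sum_apply, tensorInner_tmul, hB, Q.inner_left, Q.left_mul]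
      rw [Finset.sum_comm_cycle]
    rw [h]
    exact IsPositiveElement.sum _ _ fun k _ => Q.inner_self_pos _
  inner_right z w a := by
    induction z with
    | zero => simp
    | add z z' hz hz' => simp only [map_add, LinearMap.add_apply, add_mul, hz, hz']
    | tmul x y =>
      induction w with
      | zero => simp
      | add w w' hw hw' => simp only [map_add, add_mul, hw, hw']
      | tmul x' y' =>
        simp only [LinearMap.comp_apply, LinearMap.coe_lTensorHom, LinearMap.lTensor_tmul,
          tensorInner_tmul]
        rw [← star_star (P.inner x x'), ← Q.inner_left, Q.inner_right, Q.inner_left]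
  right_mul a b z := by
    induction z with
    | zero => simp
    | add z z' hz hz' => simp only [map_add, hz, hz']
    | tmul x y => simp [Q.right_mul]
  left_mul a b z := by
    induction z with
    | zero => simp
    | add z z' hz hz' => simp only [map_add, hz, hz']
    | tmul x y => simp [P.left_mul]
  inner_left a z w := by
    induction z with
    | zero => simp
    | add z z' hz hz' => simp only [map_add, LinearMap.add_apply, hz, hz']
    | tmul x y =>
      induction w with
      | zero => simp
      | add w w' hw hw' => simp only [map_add, hw, hw']
      | tmul x' y' =>
        simp only [LinearMap.comp_apply, LinearMap.coe_rTensorHom, LinearMap.rTensor_tmul,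
          tensorInner_tmul, P.inner_left]

section Bounds

variable (P : SemiCorrespondence A X)

theorem norm_inner_sq_le (x y : X) :
    ‖P.inner x y‖ ^ 2 ≤ ‖P.inner x x‖ * ‖P.inner y y‖ := by
  let _ : PartialOrder A := CStarAlgebra.spectralOrder A
  have _ : StarOrderedRing A := CStarAlgebra.spectralOrderedRing A
  have key : ∀ t : ℝ, 0 < t → ‖P.inner x x‖ ≤ t →
      ‖P.inner x y‖ ^ 2 ≤ t * ‖P.inner y y‖ := by
    intro t ht hxt
    set a := P.inner x y with ha
    have hpos := (isPositiveElement_iff_nonneg _).1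
      (P.inner_self_pos (P.right a x - (t : ℂ) • y))
    have hexp : P.inner (P.right a x - (t : ℂ) • y) (P.right a x - (t : ℂ) • y)
        = star a * P.inner x x * a - t • (star a * a) - t • (star a * a)
          + t • t • P.inner y y := by
      have h1 : P.inner y x = star a := by rw [ha, P.star_inner]
      simp only [map_sub, LinearMap.sub_apply, map_smulₛₗ, LinearMap.smul_apply, P.inner_right,
        P.right_inner, RingHom.id_apply, Complex.conj_ofReal, ← ha, h1]
      simp only [Complex.coe_smul, mul_assoc, smul_sub]
      abel
    have hconj : star a * P.inner x x * a ≤ t • (star a * a) :=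
      (CStarAlgebra.star_left_conjugate_le_norm_smul
        (hb := (isPositiveElement_iff_nonneg _).1 (P.inner_self_pos x) |>.isSelfAdjoint)).trans
        (smul_le_smul_of_nonneg_right hxt (star_mul_self_nonneg a))
    have hle : t • (star a * a) ≤ t • t • P.inner y y := by
      rw [hexp] at hpos
      rw [← sub_nonneg]
      refine hpos.trans ?_
      rw [← sub_nonneg]
      have : t • t • P.inner y y - t • (star a * a) - (star a * P.inner x x * a
          - t • (star a * a) - t • (star a * a) + t • t • P.inner y y)
          = t • (star a * a) - star a * P.inner x x * a := by abel
      rw [this, sub_nonneg]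
      exact hconj
    have hn := CStarAlgebra.norm_le_norm_of_nonneg_of_le
      (smul_nonneg ht.le (star_mul_self_nonneg a)) hle
    rw [norm_smul, norm_smul, norm_smul, CStarRing.norm_star_mul_self, Real.norm_of_nonneg ht.le]
      at hn
    have := le_of_mul_le_mul_left hn ht
    rwa [sq]
  have hlim : Filter.Tendsto (fun ε : ℝ => (‖P.inner x x‖ + ε) * ‖P.inner y y‖)
      (nhdsWithin 0 (Set.Ioi 0)) (nhds ((‖P.inner x x‖ + 0) * ‖P.inner y y‖)) :=
    Filter.Tendsto.mono_left (Continuous.tendsto (by fun_prop) 0) nhdsWithin_le_nhds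
  rw [add_zero] at hlim
  refine ge_of_tendsto hlim ?_
  filter_upwards [self_mem_nhdsWithin] with ε hε
  exact key _ (add_pos_of_nonneg_of_pos (norm_nonneg _) hε) (le_add_of_nonneg_right hε.le)

theorem norm_inner_right_le (a : A) (x : X) :
    ‖P.inner (P.right a x) (P.right a x)‖ ≤ ‖a‖ ^ 2 * ‖P.inner x x‖ := by
  rw [P.inner_right, P.right_inner]
  refine (norm_mul_le _ _).trans ?_
  refine (mul_le_mul_of_nonneg_right (norm_mul_le _ _) (norm_nonneg _)).trans ?_
  rw [norm_star]
  exact le_of_eq (by ring)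

theorem norm_inner_left_le (a : A) (x : X) :
    ‖P.inner (P.left a x) (P.left a x)‖ ≤ ‖a‖ ^ 2 * ‖P.inner x x‖ := by
  let _ : PartialOrder A := CStarAlgebra.spectralOrder A
  have _ : StarOrderedRing A := CStarAlgebra.spectralOrderedRing A
  let _ : PartialOrder (Unitization ℂ A) := CStarAlgebra.spectralOrder _
  have _ : StarOrderedRing (Unitization ℂ A) := CStarAlgebra.spectralOrderedRing _
  have hle : star (a : Unitization ℂ A) * a ≤ algebraMap ℝ _ (‖a‖ ^ 2) := by
    have h := IsSelfAdjoint.le_algebraMap_norm_self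
      (IsSelfAdjoint.star_mul_self (a : Unitization ℂ A))
    rwa [CStarRing.norm_star_mul_self, Unitization.norm_inr, ← sq] at h
  obtain ⟨c, hc⟩ := CStarAlgebra.nonneg_iff_eq_star_mul_self.1 (sub_nonneg.2 hle)
  have h1 := congrArg (fun u : Unitization ℂ A => u.fst) hc
  have h2 := congrArg (fun u : Unitization ℂ A => u.snd) hc
  have h3 : (starRingEnd ℂ) c.fst * c.fst = ((‖a‖ ^ 2 : ℝ) : ℂ) := by
    simpa [Algebra.algebraMap_eq_smul_one, sub_eq_add_neg] using h1.symm
  have h4 : (starRingEnd ℂ) c.fst • c.snd + c.fst • star c.snd + star c.snd * c.snd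
      = -(star a * a) := by
    simpa [Algebra.algebraMap_eq_smul_one, sub_eq_add_neg] using h2.symm
  have hpos := (isPositiveElement_iff_nonneg _).1
    (P.inner_self_pos (c.fst • x + P.left c.snd x))
  have hexp : P.inner (c.fst • x + P.left c.snd x) (c.fst • x + P.left c.snd x)
      = (‖a‖ ^ 2) • P.inner x x - P.inner (P.left a x) (P.left a x) := by
    rw [P.inner_left a, ← P.left_mul]
    have h5 := congrArg (fun b => P.inner x (P.left b x)) h4
    simp only [map_add, map_neg, map_smul, LinearMap.add_apply, LinearMap.neg_apply,
      LinearMap.smul_apply] at h5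
    rw [← Complex.coe_smul, ← h3, mul_comm, sub_eq_add_neg, ← h5]
    simp only [map_add, LinearMap.add_apply, map_smulₛₗ, LinearMap.smul_apply, P.inner_left,
      ← P.left_mul, RingHom.id_apply, mul_smul, smul_add]
    abel
  rw [hexp, sub_nonneg] at hpos
  have hn := CStarAlgebra.norm_le_norm_of_nonneg_of_le
    ((isPositiveElement_iff_nonneg _).1 (P.inner_self_pos (P.left a x))) hpos
  rwa [norm_smul, Real.norm_of_nonneg (by positivity)] at hn

end Bounds

/-- The space `X` of a semi-inner product correspondence, with the seminorm
`‖x‖ = ‖⟨x, x⟩‖ ^ (1 / 2)`. -/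
def Space (_ : SemiCorrespondence A X) : Type _ := X

section Space

variable (P : SemiCorrespondence A X)

instance : AddCommGroup P.Space := inferInstanceAs (AddCommGroup X)

instance : Module ℂ P.Space := inferInstanceAs (Module ℂ X)

/-- The structure `P`, seen on `P.Space`. -/
def onSpace : SemiCorrespondence A P.Space := P

noncomputable instance : Norm P.Space := ⟨fun x => √‖P.onSpace.inner x x‖⟩

theorem space_norm_sq (x : P.Space) : ‖x‖ ^ 2 = ‖P.onSpace.inner x x‖ :=
  Real.sq_sqrt (norm_nonneg _)

theorem norm_inner_le (x y : P.Space) : ‖P.onSpace.inner x y‖ ≤ ‖x‖ * ‖y‖ := by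
  have h := P.onSpace.norm_inner_sq_le x y
  rw [← P.space_norm_sq, ← P.space_norm_sq, ← mul_pow] at h
  exact (pow_le_pow_iff_left₀ (norm_nonneg _)
    (mul_nonneg (Real.sqrt_nonneg _) (Real.sqrt_nonneg _)) two_ne_zero).1 h

theorem seminormCore : SeminormedSpace.Core ℂ P.Space where
  norm_nonneg _ := Real.sqrt_nonneg _
  norm_smul c x := by
    have h : P.onSpace.inner (c • x) (c • x) = (star c * c) • P.onSpace.inner x x := by
      rw [map_smul, map_smulₛₗ, LinearMap.smul_apply, smul_smul, mul_comm]
      rfl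
    change √‖P.onSpace.inner (c • x) (c • x)‖ = ‖c‖ * √‖P.onSpace.inner x x‖
    rw [h, norm_smul, CStarRing.norm_star_mul_self, Real.sqrt_mul (by positivity),
      Real.sqrt_mul_self (norm_nonneg _)]
  norm_triangle x y := by
    have hx : 0 ≤ ‖x‖ := Real.sqrt_nonneg _
    have hy : 0 ≤ ‖y‖ := Real.sqrt_nonneg _
    have hxy : 0 ≤ ‖x + y‖ := Real.sqrt_nonneg _
    refine (pow_le_pow_iff_left₀ hxy (add_nonneg hx hy) two_ne_zero).1 ?_
    rw [P.space_norm_sq]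
    have h : P.onSpace.inner (x + y) (x + y)
        = P.onSpace.inner x x + P.onSpace.inner x y + (P.onSpace.inner y x + P.onSpace.inner y y) := by
      simp only [map_add, LinearMap.add_apply]
      abel
    rw [h]
    refine (norm_add_le _ _).trans ((add_le_add (norm_add_le _ _) (norm_add_le _ _)).trans ?_)
    have h1 := P.norm_inner_le x y
    have h2 := P.norm_inner_le y x
    rw [← P.space_norm_sq, ← P.space_norm_sq]
    nlinarith

noncomputable instance : SeminormedAddCommGroup P.Space :=
  SeminormedAddCommGroup.ofCore P.seminormCore

noncomputable instance : NormedSpace ℂ P.Space where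
  norm_smul_le c x := (P.seminormCore.norm_smul c x).le

theorem norm_right_le (a : A) (x : P.Space) : ‖P.onSpace.right a x‖ ≤ ‖a‖ * ‖x‖ := by
  refine (pow_le_pow_iff_left₀ (norm_nonneg _) (by positivity) two_ne_zero).1 ?_
  rw [mul_pow, P.space_norm_sq, P.space_norm_sq]
  exact P.onSpace.norm_inner_right_le a x

theorem norm_left_le (a : A) (x : P.Space) : ‖P.onSpace.left a x‖ ≤ ‖a‖ * ‖x‖ := by
  refine (pow_le_pow_iff_left₀ (norm_nonneg _) (by positivity) two_ne_zero).1 ?_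
  rw [mul_pow, P.space_norm_sq, P.space_norm_sq]
  exact P.onSpace.norm_inner_left_le a x

/-- The inner product as a bounded sesquilinear map. -/
noncomputable def innerL : P.Space →L⋆[ℂ] P.Space →L[ℂ] A :=
  LinearMap.mkContinuous₂ P.onSpace.inner 1
    fun x y => by rw [one_mul]; exact P.norm_inner_le x y

/-- The right action of `a` as a bounded operator. -/
noncomputable def rightL (a : A) : P.Space →L[ℂ] P.Space :=
  LinearMap.mkContinuous (P.onSpace.right a) ‖a‖
    (P.norm_right_le a)

/-- The left action of `a` as a bounded operator. -/
noncomputable def leftL (a : A) : P.Space →L[ℂ] P.Space :=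
  LinearMap.mkContinuous (P.onSpace.left a) ‖a‖
    (P.norm_left_le a)

/-- The Hausdorff completion of the space of `P`. -/
abbrev Compl : Type _ := UniformSpace.Completion P.Space

/-- Extension by continuity of the inner product in its second variable. -/
noncomputable def innerComplAux : P.Space →L⋆[ℂ] P.Compl →L[ℂ] A :=
  LinearMap.mkContinuous
    { toFun := fun x => (P.innerL x).fromCompletion
      map_add' := fun x y => ContinuousLinearMap.fromCompletion_unique _ _ fun e => by simp
      map_smul' := fun c x => ContinuousLinearMap.fromCompletion_unique _ _ fun e => by simp }
    1 fun x => by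
      rw [one_mul]
      refine ContinuousLinearMap.opNorm_le_bound _ (norm_nonneg _) fun z => ?_
      induction z using UniformSpace.Completion.induction_on with
      | hp => exact isClosed_le (by fun_prop) (by fun_prop)
      | ih y =>
        simpa using! P.norm_inner_le x y

/-- Extension by continuity of the inner product to the completion. -/
noncomputable def innerCompl : P.Compl →L⋆[ℂ] P.Compl →L[ℂ] A :=
  P.innerComplAux.fromCompletion

theorem innerCompl_coe (x y : P.Space) : P.innerCompl (x : P.Compl) (y : P.Compl) = P.onSpace.inner x y := by
  unfold innerCompl
  rw [ContinuousLinearMap.fromCompletion_apply_coe]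
  exact ContinuousLinearMap.fromCompletion_apply_coe (P.innerL x) y

theorem innerCompl_continuous : Continuous fun p : P.Compl × P.Compl => P.innerCompl p.1 p.2 := by
  fun_prop

theorem rightL_apply (a : A) (x : P.Space) : P.rightL a x = P.onSpace.right a x := rfl

theorem leftL_apply (a : A) (x : P.Space) : P.leftL a x = P.onSpace.left a x := rfl

/-- Extension by continuity of the right action to the completion. -/
noncomputable def rightCompl : A →ₗ[ℂ] P.Compl →ₗ[ℂ] P.Compl where
  toFun a := ((P.rightL a).completion : P.Compl →L[ℂ] P.Compl)
  map_add' a b := by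
    refine LinearMap.ext fun z => ?_
    simp only [LinearMap.add_apply, ContinuousLinearMap.coe_coe]
    induction z using UniformSpace.Completion.induction_on with
    | hp => exact isClosed_eq (by fun_prop) (by fun_prop)
    | ih x =>
      simp only [ContinuousLinearMap.completion_apply_coe, rightL_apply, map_add,
        LinearMap.add_apply, UniformSpace.Completion.coe_add]
  map_smul' c a := by
    refine LinearMap.ext fun z => ?_
    simp only [LinearMap.smul_apply, ContinuousLinearMap.coe_coe, RingHom.id_apply]
    induction z using UniformSpace.Completion.induction_on with
    | hp =>
      exact isClosed_eq (P.rightL (c • a)).completion.continuous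
        ((P.rightL a).completion.continuous.const_smul c)
    | ih x =>
      simp only [ContinuousLinearMap.completion_apply_coe, rightL_apply, map_smul,
        LinearMap.smul_apply, UniformSpace.Completion.coe_smul]

@[fun_prop]
theorem rightCompl_continuous (a : A) : Continuous fun z : P.Compl => P.rightCompl a z :=
  (P.rightL a).completion.continuous

theorem rightCompl_coe (a : A) (x : P.Space) :
    P.rightCompl a (x : P.Compl) = (P.onSpace.right a x : P.Space) :=
  ContinuousLinearMap.completion_apply_coe _ _

/-- Extension by continuity of the left action to the completion. -/
noncomputable def leftCompl : A →ₗ[ℂ] P.Compl →ₗ[ℂ] P.Compl where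
  toFun a := ((P.leftL a).completion : P.Compl →L[ℂ] P.Compl)
  map_add' a b := by
    refine LinearMap.ext fun z => ?_
    simp only [LinearMap.add_apply, ContinuousLinearMap.coe_coe]
    induction z using UniformSpace.Completion.induction_on with
    | hp => exact isClosed_eq (by fun_prop) (by fun_prop)
    | ih x =>
      simp only [ContinuousLinearMap.completion_apply_coe, leftL_apply, map_add,
        LinearMap.add_apply, UniformSpace.Completion.coe_add]
  map_smul' c a := by
    refine LinearMap.ext fun z => ?_
    simp only [LinearMap.smul_apply, ContinuousLinearMap.coe_coe, RingHom.id_apply]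
    induction z using UniformSpace.Completion.induction_on with
    | hp =>
      exact isClosed_eq (P.leftL (c • a)).completion.continuous
        ((P.leftL a).completion.continuous.const_smul c)
    | ih x =>
      simp only [ContinuousLinearMap.completion_apply_coe, leftL_apply, map_smul,
        LinearMap.smul_apply, UniformSpace.Completion.coe_smul]

@[fun_prop]
theorem leftCompl_continuous (a : A) : Continuous fun z : P.Compl => P.leftCompl a z :=
  (P.leftL a).completion.continuous

theorem leftCompl_coe (a : A) (x : P.Space) :
    P.leftCompl a (x : P.Compl) = (P.onSpace.left a x : P.Space) :=
  ContinuousLinearMap.completion_apply_coe _ _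

/-- The correspondence structure on the completion, extending that of `P` by continuity. -/
noncomputable def complStr : SemiCorrespondence A P.Compl where
  inner := P.innerCompl.toLinearMap₁₂
  right := P.rightCompl
  left := P.leftCompl
  star_inner z w := by
    simp only [ContinuousLinearMap.toLinearMap₁₂_apply_apply_apply]
    induction z, w using UniformSpace.Completion.induction_on₂ with
    | hp => exact isClosed_eq (by fun_prop) (by fun_prop)
    | ih x y => rw [innerCompl_coe, innerCompl_coe, P.onSpace.star_inner]
  inner_self_pos z := by
    simp only [ContinuousLinearMap.toLinearMap₁₂_apply_apply_apply]
    let _ : PartialOrder A := CStarAlgebra.spectralOrder A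
    have _ : StarOrderedRing A := CStarAlgebra.spectralOrderedRing A
    rw [isPositiveElement_iff_nonneg]
    induction z using UniformSpace.Completion.induction_on with
    | hp =>
      exact CStarAlgebra.isClosed_nonneg.preimage
        (P.innerCompl_continuous.comp (continuous_id.prodMk continuous_id))
    | ih x =>
      rw [innerCompl_coe]
      exact (isPositiveElement_iff_nonneg _).1 (P.onSpace.inner_self_pos x)
  inner_right z w a := by
    simp only [ContinuousLinearMap.toLinearMap₁₂_apply_apply_apply]
    induction z, w using UniformSpace.Completion.induction_on₂ with
    | hp => exact isClosed_eq (by fun_prop) (by fun_prop)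
    | ih x y =>
      rw [rightCompl_coe, innerCompl_coe, innerCompl_coe]
      exact P.onSpace.inner_right x y a
  right_mul a b z := by
    induction z using UniformSpace.Completion.induction_on with
    | hp => exact isClosed_eq (by fun_prop) (by fun_prop)
    | ih x => simp only [rightCompl_coe, P.onSpace.right_mul]
  left_mul a b z := by
    induction z using UniformSpace.Completion.induction_on with
    | hp => exact isClosed_eq (by fun_prop) (by fun_prop)
    | ih x => simp only [leftCompl_coe, P.onSpace.left_mul]
  inner_left a z w := by
    simp only [ContinuousLinearMap.toLinearMap₁₂_apply_apply_apply]
    induction z, w using UniformSpace.Completion.induction_on₂ with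
    | hp => exact isClosed_eq (by fun_prop) (by fun_prop)
    | ih x y =>
      rw [leftCompl_coe, leftCompl_coe, innerCompl_coe, innerCompl_coe]
      exact P.onSpace.inner_left a x y

theorem complStr_norm_sq (z : P.Compl) : ‖z‖ ^ 2 = ‖P.complStr.inner z z‖ := by
  change ‖z‖ ^ 2 = ‖P.innerCompl z z‖
  induction z using UniformSpace.Completion.induction_on with
  | hp => exact isClosed_eq (by fun_prop) (by fun_prop)
  | ih x => rw [innerCompl_coe, UniformSpace.Completion.norm_coe, P.space_norm_sq]

end Space

end SemiCorrespondence

namespace CStarCorrespondence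

universe u

variable {A : Type u} [NonUnitalCStarAlgebra A]

/-- The Hausdorff completion of a semi-inner product correspondence. -/
noncomputable def ofCompletion {X : Type u} [AddCommGroup X] [Module ℂ X]
    (P : SemiCorrespondence A X) : CStarCorrespondence A where
  carrier := P.Compl
  str := P.complStr
  norm_sq := P.complStr_norm_sq

/-- The (interior, `A`-balanced) tensor product `X ⊗_A Y` of C*-correspondences over `A`: the
Hausdorff completion of the algebraic tensor product for
`⟨x ⊗ y, x' ⊗ y'⟩ = ⟨y, ⟨x, x'⟩ · y'⟩`. -/
noncomputable def tensor (X Y : CStarCorrespondence A) : CStarCorrespondence A :=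
  ofCompletion (X.str.tensor Y.str)

variable (A) in
/-- The identity correspondence: `A` over itself, with `⟨a, b⟩ = a* b` and with multiplication as
the left and right action. -/
noncomputable def identity : CStarCorrespondence A where
  carrier := A
  str :=
    { inner := LinearMap.mk₂'ₛₗ (starRingEnd ℂ) (RingHom.id ℂ) (fun a b => star a * b)
        (fun _ _ _ => by simp [add_mul]) (fun _ _ _ => by simp [smul_mul_assoc])
        (fun _ _ _ => by simp [mul_add]) (fun _ _ _ => by simp [mul_smul_comm])
      right := (LinearMap.mul ℂ A).flip
      left := LinearMap.mul ℂ A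
      star_inner := fun _ _ => by simp
      inner_self_pos := fun a => ⟨a, rfl⟩
      inner_right := fun _ _ _ => by simp [mul_assoc]
      right_mul := fun _ _ _ => by simp [mul_assoc]
      left_mul := fun _ _ _ => by simp [mul_assoc]
      inner_left := fun _ _ _ => by simp [mul_assoc] }
  norm_sq a := by simp [CStarRing.norm_star_mul_self, sq]

/-- The tensor powers `X^{⊗ n} = X ⊗_A (X ⊗_A ⋯ )`, with `X^{⊗ 0} = A`. -/
noncomputable def tensorPower (X : CStarCorrespondence A) : ℕ → CStarCorrespondence A
  | 0 => identity A
  | 1 => X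
  | n + 2 => tensor X (tensorPower X (n + 1))

/-- Isomorphism of C*-correspondences: a bijection that preserves the left action and the inner
product (it is then automatically linear and preserves the right action). -/
def Isomorphic (X Y : CStarCorrespondence A) : Prop :=
  ∃ Φ : X.carrier → Y.carrier, Function.Bijective Φ ∧
    (∀ a x, Φ (X.str.left a x) = Y.str.left a (Φ x)) ∧
    ∀ x x', Y.str.inner (Φ x) (Φ x') = X.str.inner x x'

/-- `X` is nonperiodic if `X^{⊗ n} ≅ A` only for `n = 0`. -/
def Nonperiodic (X : CStarCorrespondence A) : Prop :=
  ∀ n : ℕ, Isomorphic (X.tensorPower n) (identity A) → n = 0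

end CStarCorrespondence

/-- A directed graph `E = (E⁰, E¹, r, s)`; loops and multiple edges are allowed. -/
structure DirectedGraph.{u} where
  Vertex : Type u
  Edge : Type u
  r : Edge → Vertex
  s : Edge → Vertex

namespace DirectedGraph

universe u

variable (E : DirectedGraph.{u})

/-- The vertex set carries the discrete topology. -/
instance : TopologicalSpace E.Vertex := ⊥

instance : DiscreteTopology E.Vertex := ⟨rfl⟩

/-- The set `r⁻¹(v)` of edges with range `v`. -/
abbrev Fiber (v : E.Vertex) : Type u := {e : E.Edge // E.r e = v}

/-- The function `v ↦ ∑_{r(e) = v} |ξ(e)|²`. -/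
noncomputable def normSq (ξ : E.Edge → ℂ) (v : E.Vertex) : ℝ := ∑' e : E.Fiber v, ‖ξ e‖ ^ 2

/-- Membership in `X(E)`: the function `v ↦ ∑_{r(e) = v} |ξ(e)|²` is finite everywhere and belongs
to `C₀(E⁰)`. -/
def MemX (ξ : E.Edge → ℂ) : Prop :=
  (∀ v, Summable fun e : E.Fiber v => ‖ξ e‖ ^ 2) ∧
    Filter.Tendsto (E.normSq ξ) (Filter.cocompact E.Vertex) (nhds 0)

variable {E}

theorem normSq_nonneg (ξ : E.Edge → ℂ) (v : E.Vertex) : 0 ≤ E.normSq ξ v :=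
  tsum_nonneg fun _ => by positivity

theorem MemX.of_le {ξ η ζ : E.Edge → ℂ} (hξ : E.MemX ξ) (hη : E.MemX η) (C D : ℝ)
    (h : ∀ e, ‖ζ e‖ ^ 2 ≤ C * ‖ξ e‖ ^ 2 + D * ‖η e‖ ^ 2) : E.MemX ζ := by
  have hsum : ∀ v, Summable fun e : E.Fiber v => C * ‖ξ e‖ ^ 2 + D * ‖η e‖ ^ 2 :=
    fun v => ((hξ.1 v).mul_left C).add ((hη.1 v).mul_left D)
  have hζ : ∀ v, Summable fun e : E.Fiber v => ‖ζ e‖ ^ 2 := fun v =>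
    Summable.of_nonneg_of_le (fun _ => by positivity) (fun e => h e) (hsum v)
  refine ⟨hζ, ?_⟩
  have hlim := (hξ.2.const_mul C).add (hη.2.const_mul D)
  simp only [mul_zero, add_zero] at hlim
  refine squeeze_zero (normSq_nonneg ζ) (fun v => ?_) hlim
  refine (Summable.tsum_le_tsum (fun e : E.Fiber v => h e) (hζ v) (hsum v)).trans (le_of_eq ?_)
  rw [((hξ.1 v).mul_left C).tsum_add ((hη.1 v).mul_left D), tsum_mul_left, tsum_mul_left]
  rfl

theorem norm_add_sq_le (a b : ℂ) : ‖a + b‖ ^ 2 ≤ 2 * ‖a‖ ^ 2 + 2 * ‖b‖ ^ 2 := by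
  have h := norm_add_le a b
  have h' := pow_le_pow_left₀ (norm_nonneg _) h 2
  nlinarith [sq_nonneg (‖a‖ - ‖b‖)]

variable (E) in
/-- The complex vector space underlying `X(E)`. -/
def moduleX : Submodule ℂ (E.Edge → ℂ) where
  carrier := {ξ | E.MemX ξ}
  zero_mem' := by
    refine ⟨fun v => ?_, ?_⟩
    · simp
    · have : E.normSq 0 = 0 := by
        funext v
        simp [normSq]
      rw [this]
      exact tendsto_const_nhds
  add_mem' hξ hη := MemX.of_le hξ hη 2 2 fun _ => norm_add_sq_le _ _
  smul_mem' c ξ hξ := MemX.of_le hξ hξ (‖c‖ ^ 2) 0 fun e => by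
    simp [mul_pow]

theorem norm_conj_mul_le (a b : ℂ) : ‖starRingEnd ℂ a * b‖ ≤ ‖a‖ ^ 2 + ‖b‖ ^ 2 := by
  rw [norm_mul, RCLike.norm_conj]
  nlinarith [sq_nonneg (‖a‖ - ‖b‖), sq_nonneg ‖a‖, sq_nonneg ‖b‖]

theorem summable_inner (ξ η : E.moduleX) (v : E.Vertex) :
    Summable fun e : E.Fiber v => starRingEnd ℂ (ξ.1 e) * η.1 e :=
  Summable.of_norm_bounded ((ξ.2.1 v).add (η.2.1 v)) fun _ => norm_conj_mul_le _ _

/-- The inner product `⟨ξ, η⟩(v) = ∑_{r(e) = v} conj(ξ(e)) η(e)`, an element of `C₀(E⁰)`. -/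
noncomputable def innerX (ξ η : E.moduleX) : C₀(E.Vertex, ℂ) where
  toFun v := ∑' e : E.Fiber v, starRingEnd ℂ (ξ.1 e) * η.1 e
  continuous_toFun := continuous_of_discreteTopology
  zero_at_infty' := by
    have hlim := ξ.2.2.add η.2.2
    rw [add_zero] at hlim
    refine squeeze_zero_norm (fun v => ?_) hlim
    refine (tsum_of_norm_bounded ((ξ.2.1 v).add (η.2.1 v)).hasSum
      fun _ => norm_conj_mul_le _ _).trans (le_of_eq ?_)
    exact (ξ.2.1 v).tsum_add (η.2.1 v)

theorem innerX_apply (ξ η : E.moduleX) (v : E.Vertex) :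
    innerX ξ η v = ∑' e : E.Fiber v, starRingEnd ℂ (ξ.1 e) * η.1 e := rfl

theorem innerX_self_apply (ξ : E.moduleX) (v : E.Vertex) :
    innerX ξ ξ v = (E.normSq ξ.1 v : ℂ) := by
  rw [innerX_apply, normSq, Complex.ofReal_tsum]
  refine tsum_congr fun e => ?_
  rw [Complex.conj_mul', Complex.ofReal_pow]

theorem norm_coe_le (a : C₀(E.Vertex, ℂ)) (v : E.Vertex) : ‖a v‖ ≤ ‖a‖ :=
  a.toBCF.norm_coe_le_norm v

theorem norm_mul_coe_sq_le (a : C₀(E.Vertex, ℂ)) (v : E.Vertex) (z : ℂ) :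
    ‖a v * z‖ ^ 2 ≤ ‖a‖ ^ 2 * ‖z‖ ^ 2 + 0 * ‖z‖ ^ 2 := by
  rw [norm_mul, mul_pow, zero_mul, add_zero]
  gcongr
  exact norm_coe_le a v

theorem memX_right (a : C₀(E.Vertex, ℂ)) {ξ : E.Edge → ℂ} (hξ : E.MemX ξ) :
    E.MemX fun e => ξ e * a (E.r e) :=
  hξ.of_le hξ (‖a‖ ^ 2) 0 fun e => by
    rw [mul_comm (ξ e)]
    exact norm_mul_coe_sq_le a (E.r e) (ξ e)

theorem memX_left (a : C₀(E.Vertex, ℂ)) {ξ : E.Edge → ℂ} (hξ : E.MemX ξ) :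
    E.MemX fun e => a (E.s e) * ξ e :=
  hξ.of_le hξ (‖a‖ ^ 2) 0 fun e => norm_mul_coe_sq_le a (E.s e) (ξ e)

/-- The right action `(ξ · a)(e) = ξ(e) a(r(e))`. -/
noncomputable def rightX (a : C₀(E.Vertex, ℂ)) (ξ : E.moduleX) : E.moduleX :=
  ⟨fun e => ξ.1 e * a (E.r e), memX_right a ξ.2⟩

/-- The left action `(a · ξ)(e) = a(s(e)) ξ(e)`. -/
noncomputable def leftX (a : C₀(E.Vertex, ℂ)) (ξ : E.moduleX) : E.moduleX :=
  ⟨fun e => a (E.s e) * ξ.1 e, memX_left a ξ.2⟩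

variable (E) in
/-- The inner product and the actions of `C₀(E⁰)` on `X(E)`. -/
noncomputable def strX : SemiCorrespondence C₀(E.Vertex, ℂ) E.moduleX where
  inner := LinearMap.mk₂'ₛₗ (starRingEnd ℂ) (RingHom.id ℂ) innerX
    (fun ξ ξ' η => ZeroAtInftyContinuousMap.ext fun v => by
      simp only [innerX_apply, ZeroAtInftyContinuousMap.add_apply]
      rw [← (summable_inner ξ η v).tsum_add (summable_inner ξ' η v)]
      exact tsum_congr fun e => by simp [add_mul])
    (fun c ξ η => ZeroAtInftyContinuousMap.ext fun v => by
      simp only [innerX_apply, ZeroAtInftyContinuousMap.smul_apply, smul_eq_mul]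
      rw [← tsum_mul_left]
      exact tsum_congr fun e => by simp [mul_assoc])
    (fun ξ η η' => ZeroAtInftyContinuousMap.ext fun v => by
      simp only [innerX_apply, ZeroAtInftyContinuousMap.add_apply]
      rw [← (summable_inner ξ η v).tsum_add (summable_inner ξ η' v)]
      exact tsum_congr fun e => by simp [mul_add])
    (fun c ξ η => ZeroAtInftyContinuousMap.ext fun v => by
      simp only [innerX_apply, ZeroAtInftyContinuousMap.smul_apply, smul_eq_mul, RingHom.id_apply]
      rw [← tsum_mul_left]
      exact tsum_congr fun e => by simp [mul_left_comm])
  right := LinearMap.mk₂ ℂ rightX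
    (fun _ _ _ => Subtype.ext <| funext fun _ => mul_add _ _ _)
    (fun _ _ _ => Subtype.ext <| funext fun _ => mul_left_comm _ _ _)
    (fun _ _ _ => Subtype.ext <| funext fun _ => add_mul _ _ _)
    (fun _ _ _ => Subtype.ext <| funext fun _ => mul_assoc _ _ _)
  left := LinearMap.mk₂ ℂ leftX
    (fun _ _ _ => Subtype.ext <| funext fun _ => add_mul _ _ _)
    (fun _ _ _ => Subtype.ext <| funext fun _ => mul_assoc _ _ _)
    (fun _ _ _ => Subtype.ext <| funext fun _ => mul_add _ _ _)
    (fun _ _ _ => Subtype.ext <| funext fun _ => mul_left_comm _ _ _)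
  star_inner ξ η := ZeroAtInftyContinuousMap.ext fun v => by
    simp only [LinearMap.mk₂'ₛₗ_apply, ZeroAtInftyContinuousMap.star_apply, innerX_apply]
    rw [← starRingEnd_apply, Complex.conj_tsum]
    exact tsum_congr fun e => by simp [mul_comm]
  inner_self_pos ξ := by
    refine ⟨⟨⟨fun v => (√(E.normSq ξ.1 v) : ℂ), continuous_of_discreteTopology⟩, ?_⟩, ?_⟩
    · have h := (Complex.continuous_ofReal.tendsto _).comp
        ((Real.continuous_sqrt.tendsto 0).comp ξ.2.2)
      rw [Real.sqrt_zero, Complex.ofReal_zero] at h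
      exact h
    · refine ZeroAtInftyContinuousMap.ext fun v => ?_
      simp only [LinearMap.mk₂'ₛₗ_apply, innerX_self_apply]
      change _ = star (√(E.normSq ξ.1 v) : ℂ) * (√(E.normSq ξ.1 v) : ℂ)
      rw [← starRingEnd_apply, Complex.conj_ofReal, ← Complex.ofReal_mul,
        Real.mul_self_sqrt (normSq_nonneg _ _)]
  inner_right ξ η a := ZeroAtInftyContinuousMap.ext fun v => by
    simp only [LinearMap.mk₂'ₛₗ_apply, LinearMap.mk₂_apply, innerX_apply,
      ZeroAtInftyContinuousMap.mul_apply]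
    rw [← tsum_mul_right]
    refine tsum_congr fun e => ?_
    obtain ⟨e, rfl⟩ := e
    exact (mul_assoc _ _ _).symm
  right_mul _ _ _ := Subtype.ext <| funext fun _ => (mul_assoc _ _ _).symm
  left_mul _ _ _ := Subtype.ext <| funext fun _ => mul_assoc _ _ _
  inner_left a ξ η := ZeroAtInftyContinuousMap.ext fun v => by
    simp only [LinearMap.mk₂'ₛₗ_apply, LinearMap.mk₂_apply, innerX_apply]
    refine tsum_congr fun e => ?_
    change starRingEnd ℂ (a (E.s e) * ξ.1 e) * η.1 e
      = starRingEnd ℂ (ξ.1 e) * (star (a (E.s e)) * η.1 e)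
    rw [map_mul, starRingEnd_apply, starRingEnd_apply]
    ring

/-- An element of the normed space `X(E)` as a function on the edges. -/
def toX (ξ : E.strX.Space) : E.moduleX := ξ

theorem normX_sq (ξ : E.strX.Space) : ‖ξ‖ ^ 2 = ‖innerX (toX ξ) (toX ξ)‖ :=
  E.strX.space_norm_sq ξ

theorem norm_innerX_self_apply (ξ : E.moduleX) (v : E.Vertex) :
    ‖innerX ξ ξ v‖ = E.normSq ξ.1 v := by
  rw [innerX_self_apply, Complex.norm_real, Real.norm_of_nonneg (normSq_nonneg _ _)]

theorem normSq_le (ξ : E.strX.Space) (v : E.Vertex) : E.normSq (toX ξ).1 v ≤ ‖ξ‖ ^ 2 := by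
  rw [normX_sq, ← norm_innerX_self_apply]
  exact norm_coe_le _ v

theorem norm_apply_sq_le (ξ : E.strX.Space) (e : E.Edge) : ‖(toX ξ).1 e‖ ^ 2 ≤ ‖ξ‖ ^ 2 :=
  (((toX ξ).2.1 (E.r e)).le_tsum ⟨e, rfl⟩ fun _ _ => by positivity).trans
    (normSq_le ξ (E.r e))

theorem norm_le_of_normSq_le (ξ : E.strX.Space) (C : ℝ) (hC : 0 ≤ C)
    (h : ∀ v, E.normSq (toX ξ).1 v ≤ C ^ 2) : ‖ξ‖ ≤ C := by
  refine (pow_le_pow_iff_left₀ (norm_nonneg _) hC two_ne_zero).1 ?_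
  rw [normX_sq]
  refine (BoundedContinuousFunction.norm_le (f := (innerX (toX ξ) (toX ξ)).toBCF)
    (sq_nonneg C)).2 fun v => ?_
  exact (norm_innerX_self_apply _ v).trans_le (h v)

theorem eq_zero_of_norm_eq_zero (ξ : E.strX.Space) (h : ‖ξ‖ = 0) : ξ = 0 :=
  Subtype.ext <| funext fun e => by
    have := norm_apply_sq_le ξ e
    rw [h] at this
    have h0 : ‖(toX ξ).1 e‖ ^ 2 = 0 := le_antisymm (by simpa using this) (by positivity)
    exact norm_eq_zero.1 (pow_eq_zero_iff two_ne_zero |>.1 h0)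

instance completeSpaceX : CompleteSpace E.strX.Space := by
  refine UniformSpace.complete_of_cauchySeq_tendsto fun u hu => ?_
  let f : ℕ → E.Edge → ℂ := fun n => (toX (u n)).1
  have hf : ∀ n, E.MemX (f n) := fun n => (toX (u n)).2
  have hcau : ∀ ε > 0, ∃ N, ∀ n ≥ N, ∀ m ≥ N, ∀ v, E.normSq (f n - f m) v ≤ ε ^ 2 := by
    intro ε hε
    obtain ⟨N, hN⟩ := Metric.cauchySeq_iff.1 hu ε hε
    refine ⟨N, fun n hn m hm v => (normSq_le (u n - u m) v).trans ?_⟩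
    have := (hN n hn m hm).le
    rw [dist_eq_norm] at this
    exact pow_le_pow_left₀ (norm_nonneg _) this 2
  have hsub : ∀ n m, E.MemX (f n - f m) := fun n m => E.moduleX.sub_mem (hf n) (hf m)
  have hpt : ∀ e, CauchySeq fun n => f n e := by
    intro e
    refine Metric.cauchySeq_iff.2 fun ε hε => ?_
    obtain ⟨N, hN⟩ := hcau (ε / 2) (by positivity)
    refine ⟨N, fun n hn m hm => ?_⟩
    have h1 := ((hsub n m).1 (E.r e)).le_tsum ⟨e, rfl⟩ fun _ _ => by positivity
    have h2 := h1.trans (hN n hn m hm (E.r e))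
    have h3 := (pow_le_pow_iff_left₀ (norm_nonneg _) (by positivity) two_ne_zero).1 h2
    rw [dist_eq_norm]
    exact lt_of_le_of_lt h3 (by linarith)
  choose g hg using fun e => cauchySeq_tendsto_of_complete (hpt e)
  have hfin : ∀ ε > 0, ∃ N, ∀ n ≥ N, ∀ v, ∀ F : Finset (E.Fiber v),
      ∑ e ∈ F, ‖(f n - g) e‖ ^ 2 ≤ ε ^ 2 := by
    intro ε hε
    obtain ⟨N, hN⟩ := hcau ε hε
    refine ⟨N, fun n hn v F => ?_⟩
    have hlim : Filter.Tendsto (fun m => ∑ e ∈ F, ‖(f n - f m) e‖ ^ 2) Filter.atTop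
        (nhds (∑ e ∈ F, ‖(f n - g) e‖ ^ 2)) :=
      tendsto_finsetSum _ fun e _ => ((tendsto_const_nhds.sub (hg e)).norm).pow 2
    refine le_of_tendsto hlim ?_
    filter_upwards [Filter.eventually_ge_atTop N] with m hm
    exact (((hsub n m).1 v).sum_le_tsum F fun _ _ => by positivity).trans (hN n hn m hm v)
  have hsum : ∀ ε > 0, ∃ N, ∀ n ≥ N, ∀ v, (Summable fun e : E.Fiber v => ‖(f n - g) e‖ ^ 2) ∧
      E.normSq (f n - g) v ≤ ε ^ 2 := by
    intro ε hε
    obtain ⟨N, hN⟩ := hfin ε hε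
    refine ⟨N, fun n hn v => ?_⟩
    have h1 : Summable fun e : E.Fiber v => ‖(f n - g) e‖ ^ 2 :=
      summable_of_sum_le (fun _ => by positivity) (hN n hn v)
    exact ⟨h1, h1.tsum_le_of_sum_le (hN n hn v)⟩
  have hle : ∀ n e, ‖g e‖ ^ 2 ≤ 2 * ‖f n e‖ ^ 2 + 2 * ‖(f n - g) e‖ ^ 2 := fun n e => by
    have h := norm_add_sq_le (f n e) (-(f n - g) e)
    rw [norm_neg] at h
    simpa using h
  have hgmem : E.MemX g := by
    have hgs : ∀ v, Summable fun e : E.Fiber v => ‖g e‖ ^ 2 := by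
      intro v
      obtain ⟨N, hN⟩ := hsum 1 one_pos
      exact Summable.of_nonneg_of_le (fun _ => by positivity) (fun e => hle N e)
        ((((hf N).1 v).mul_left 2).add ((hN N le_rfl v).1.mul_left 2))
    refine ⟨hgs, ?_⟩
    rw [Metric.tendsto_nhds]
    intro ε hε
    obtain ⟨N, hN⟩ := hsum (√(ε / 8)) (by positivity)
    have h1 := (Metric.tendsto_nhds.1 (hf N).2) (ε / 4) (by positivity)
    filter_upwards [h1] with v hv
    rw [dist_zero_right, Real.norm_of_nonneg (normSq_nonneg _ _)] at hv ⊢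
    have h2 : E.normSq g v ≤ 2 * E.normSq (f N) v + 2 * E.normSq (f N - g) v := by
      refine (Summable.tsum_le_tsum (fun e : E.Fiber v => hle N e) (hgs v)
        ((((hf N).1 v).mul_left 2).add ((hN N le_rfl v).1.mul_left 2))).trans (le_of_eq ?_)
      rw [(((hf N).1 v).mul_left 2).tsum_add ((hN N le_rfl v).1.mul_left 2), tsum_mul_left,
        tsum_mul_left]
      rfl
    have h3 := (hN N le_rfl v).2
    rw [Real.sq_sqrt (by positivity)] at h3
    linarith
  let ξ : E.strX.Space := (⟨g, hgmem⟩ : E.moduleX)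
  refine ⟨ξ, ?_⟩
  rw [Metric.tendsto_atTop]
  intro ε hε
  obtain ⟨N, hN⟩ := hsum (ε / 2) (by positivity)
  refine ⟨N, fun n hn => ?_⟩
  rw [dist_eq_norm]
  refine lt_of_le_of_lt (norm_le_of_normSq_le _ (ε / 2) (by positivity) fun v => ?_)
    (half_lt_self hε)
  exact (hN n hn v).2

noncomputable instance normedAddCommGroupX : NormedAddCommGroup E.strX.Space :=
  NormedAddCommGroup.ofSeparation eq_zero_of_norm_eq_zero

variable (E) in
/-- The graph correspondence `X(E)` over `C₀(E⁰)`. -/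
noncomputable def correspondence : CStarCorrespondence C₀(E.Vertex, ℂ) where
  carrier := E.strX.Space
  normedAddCommGroup := normedAddCommGroupX
  normedSpace := inferInstanceAs (NormedSpace ℂ E.strX.Space)
  completeSpace := completeSpaceX
  str := E.strX.onSpace
  norm_sq := E.strX.space_norm_sq

variable (E)

/-- `E` has no sinks: every vertex is the source of an edge. -/
def NoSinks : Prop := ∀ v, ∃ e, E.s e = v

/-- `E` has no sources: every vertex is the range of an edge. -/
def NoSources : Prop := ∀ v, ∃ e, E.r e = v

/-- There is an edge from `v` to `w` or an edge from `w` to `v`. -/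
def Linked (v w : E.Vertex) : Prop :=
  ∃ e, (E.s e = v ∧ E.r e = w) ∨ (E.s e = w ∧ E.r e = v)

/-- `E` is weakly connected: any two vertices are joined by a finite sequence of vertices in which
consecutive vertices are linked by an edge in one of the two directions. -/
def WeaklyConnected : Prop := ∀ v w, Relation.ReflTransGen E.Linked v w

/-- `E` is a simple cycle: for some `n ≥ 0` its vertices are distinct `v₀, …, vₙ`, and its edges are
exactly `e₀, …, eₙ` with `eᵢ` from `vᵢ` to `vᵢ₊₁`, indices modulo `n + 1`. -/
def IsSimpleCycle : Prop :=
  ∃ (n : ℕ) (v : Fin (n + 1) ≃ E.Vertex) (e : Fin (n + 1) ≃ E.Edge),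
    ∀ i, E.s (e i) = v i ∧ E.r (e i) = v (i + 1)

end DirectedGraph

/-! ### Elementary tensors in the completed balanced tensor product -/

namespace CStarCorrespondence

universe u

variable {A : Type u} [NonUnitalCStarAlgebra A]

/-! The power `X(E)^{⊗ n}` is governed by the paths of length `n`: a path gives an elementary
tensor, the left action sees its source, the inner product sees its range, and a tensor of
non-composable edges has norm zero.

Suppose `X(E)^{⊗ n} ≅ A` with `n ≥ 1`. Without sinks every edge starts a path of length `n`, and
different first edges give orthogonal nonzero vectors (`exists_path_vectors`). The part of `A` on
which the indicator of a vertex acts as the identity is one-dimensional, so two edges cannot share a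
source (`injective_source_of_isomorphic`). Then `s` is bijective, `r ∘ s⁻¹` is a surjection of a
finite set onto itself, hence a permutation, and weak connectedness makes it a single cycle
(`isSimpleCycle_of_injective_source`).

Conversely, on a cycle with `k` vertices exactly one path of length `k` starts at each vertex, and
it returns there. These paths span `X(E)^{⊗ k}` (`exists_cycle_basis`) and satisfy the same
relations as the vertex indicators in `A`, which gives the isomorphism
(`isomorphic_identity_of_cycle`). -/

/-- The canonical bilinear map `(x, y) ↦ x ⊗ y` into the completed balanced tensor product. -/
noncomputable def tmul (X Y : CStarCorrespondence A) :
    X.carrier →ₗ[ℂ] Y.carrier →ₗ[ℂ] (X.tensor Y).carrier :=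
  (TensorProduct.mk ℂ X.carrier Y.carrier).compr₂
    (UniformSpace.Completion.toComplL (𝕜 := ℂ) (E := (X.str.tensor Y.str).Space)).toLinearMap

theorem inner_tmul (X Y : CStarCorrespondence A) (x x' : X.carrier) (y y' : Y.carrier) :
    (X.tensor Y).str.inner (tmul X Y x y) (tmul X Y x' y')
      = Y.str.inner y (Y.str.left (X.str.inner x x') y') :=
  (X.str.tensor Y.str).innerCompl_coe _ _

theorem left_tmul (X Y : CStarCorrespondence A) (a : A) (x : X.carrier) (y : Y.carrier) :
    (X.tensor Y).str.left a (tmul X Y x y) = tmul X Y (X.str.left a x) y :=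
  (X.str.tensor Y.str).leftCompl_coe _ _

/-- The norm is determined by the inner product, so null vectors are already zero in the completion.
This lets a tensor of non-composable paths be discarded by computing one inner product. -/
theorem eq_zero_of_inner_self (X : CStarCorrespondence A) {x : X.carrier}
    (h : X.str.inner x x = 0) : x = 0 := by
  have h' := X.norm_sq x
  rw [h, norm_zero] at h'
  exact norm_eq_zero.1 (pow_eq_zero_iff two_ne_zero |>.1 h')

/-- If finite families span `X` and `Y`, then their elementary tensors span `X ⊗_A Y`. -/
theorem span_tmul_eq_top (X Y : CStarCorrespondence A) {ι κ : Type*} [Finite ι] [Finite κ]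
    (x : ι → X.carrier) (y : κ → Y.carrier) (hx : Submodule.span ℂ (Set.range x) = ⊤)
    (hy : Submodule.span ℂ (Set.range y) = ⊤) :
    Submodule.span ℂ (Set.range fun p : ι × κ => tmul X Y (x p.1) (y p.2)) = ⊤ := by
  set S := Submodule.span ℂ (Set.range fun p : ι × κ => tmul X Y (x p.1) (y p.2)) with hS
  -- A finite-dimensional subspace is closed, so it contains the whole completion once it contains
  -- the dense image of the algebraic tensor product.
  have hfin : FiniteDimensional ℂ S := FiniteDimensional.span_of_finite ℂ (Set.finite_range _)
  have hclosed : IsClosed (S : Set (X.tensor Y).carrier) := S.closed_of_finiteDimensional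
  have hmul : ∀ x y, tmul X Y x y ∈ S := fun x' y' => by
    have h1 : ∀ i, tmul X Y (x i) y' ∈ S := fun i => by
      have h : Submodule.span ℂ (Set.range y) ≤ S.comap (tmul X Y (x i)) := by
        rw [Submodule.span_le]
        rintro _ ⟨j, rfl⟩
        exact Submodule.subset_span ⟨(i, j), rfl⟩
      exact h (hy ▸ Submodule.mem_top)
    have h : Submodule.span ℂ (Set.range x) ≤ S.comap ((tmul X Y).flip y') := by
      rw [Submodule.span_le]
      rintro _ ⟨i, rfl⟩
      exact h1 i
    exact h (hx ▸ Submodule.mem_top)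
  rw [eq_top_iff]
  rintro z -
  change UniformSpace.Completion (X.str.tensor Y.str).Space at z
  induction z using UniformSpace.Completion.induction_on with
  | hp => exact hclosed
  | ih t =>
    -- Restated over the tensor product itself rather than its synonym `Space`, so that induction on
    -- tensors applies.
    have h : ∀ t : X.carrier ⊗[ℂ] Y.carrier,
        (UniformSpace.Completion.toComplL (𝕜 := ℂ) (E := (X.str.tensor Y.str).Space)) t ∈ S := by
      intro t
      induction t with
      | zero => exact (map_zero (UniformSpace.Completion.toComplL (𝕜 := ℂ)
          (E := (X.str.tensor Y.str).Space))).symm ▸ S.zero_mem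
      | add t t' ht ht' => exact (map_add (UniformSpace.Completion.toComplL (𝕜 := ℂ)
          (E := (X.str.tensor Y.str).Space)) t t').symm ▸ S.add_mem ht ht'
      | tmul x y => exact hmul x y
    exact h t

end CStarCorrespondence

namespace DirectedGraph

universe u

variable {E : DirectedGraph.{u}}

open CStarCorrespondence

/-! ### Indicators of vertices and edges -/

open scoped Classical in
/-- The indicator function of a vertex, as an element of `C₀(E⁰)`. -/
noncomputable def vertexIndicator (v : E.Vertex) : C₀(E.Vertex, ℂ) where
  toFun w := if w = v then 1 else 0
  continuous_toFun := continuous_of_discreteTopology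
  zero_at_infty' := by
    refine tendsto_const_nhds.congr' ?_
    filter_upwards [(isCompact_singleton (x := v)).compl_mem_cocompact] with w hw
    exact (if_neg hw).symm

theorem vertexIndicator_self (v : E.Vertex) : vertexIndicator v v = 1 := if_pos rfl

theorem vertexIndicator_of_ne {v w : E.Vertex} (h : w ≠ v) : vertexIndicator v w = 0 := if_neg h

theorem vertexIndicator_ne_zero (v : E.Vertex) : vertexIndicator v ≠ 0 := fun h => by
  have := congrArg (fun a : C₀(E.Vertex, ℂ) => a v) h
  simp [vertexIndicator_self] at this

/-- Coordinates in `A` are values at vertices. This serves both to compare inner products pointwise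
and to produce preimages when the candidate isomorphism is shown to be surjective. -/
theorem sum_smul_vertexIndicator_apply {ι : Type*} [Fintype ι] (v : ι ≃ E.Vertex) (c : ι → ℂ)
    (j : ι) : (∑ i, c i • vertexIndicator (v i)) (v j) = c j := by
  let ev : C₀(E.Vertex, ℂ) →+ ℂ :=
    { toFun := fun a => a (v j), map_zero' := rfl, map_add' := fun _ _ => rfl }
  refine (map_sum ev _ _).trans ((Finset.sum_eq_single j (fun i _ hi => ?_) (by simp)).trans ?_)
  · change c i * vertexIndicator (v i) (v j) = 0
    rw [vertexIndicator_of_ne (v.injective.ne hi.symm), mul_zero]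
  · change c j * vertexIndicator (v j) (v j) = c j
    rw [vertexIndicator_self, mul_one]

-- Each fibre of `r` meets the support in at most one edge, and `normSq` vanishes away from the
-- single vertex `r e`.
open scoped Classical in
theorem memX_single (e : E.Edge) : E.MemX (Pi.single e 1) := by
  refine ⟨fun v => summable_of_hasFiniteSupport ?_, ?_⟩
  · refine (Set.Subsingleton.finite (s := {f : E.Fiber v | f.1 = e}) ?_).subset fun f hf => ?_
    · rintro f rfl g hg
      exact Subtype.ext hg.symm
    · by_contra h
      exact hf (by simp [Pi.single_eq_of_ne (show f.1 ≠ e from h)])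
  · refine tendsto_const_nhds.congr' ?_
    filter_upwards [(isCompact_singleton (x := E.r e)).compl_mem_cocompact] with w hw
    refine ((tsum_congr fun f => ?_).trans tsum_zero).symm
    have hf : f.1 ≠ e := by
      rintro rfl
      exact hw f.2.symm
    simp [hf]

open scoped Classical in
/-- The indicator function of an edge, as an element of `X(E)`. -/
noncomputable def edgeIndicator (e : E.Edge) : E.correspondence.carrier :=
  (⟨Pi.single e 1, memX_single e⟩ : E.moduleX)

theorem left_edgeIndicator (a : C₀(E.Vertex, ℂ)) (e : E.Edge) :
    E.correspondence.str.left a (edgeIndicator e) = a (E.s e) • edgeIndicator e := by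
  classical
  refine Subtype.ext (funext fun f => ?_)
  change a (E.s f) * (Pi.single e 1 : E.Edge → ℂ) f = a (E.s e) * (Pi.single e 1 : E.Edge → ℂ) f
  by_cases h : f = e
  · rw [h]
  · simp [h]

/-- Only the fibre over `r e` contains `e`. Paired with `left_edgeIndicator`, which reads off the
source, this detects composability: in a tensor of the indicators of `e` and `f`, the indicator of
`r e` acts on `f` by its value at `s f`. -/
theorem inner_edgeIndicator_self (e : E.Edge) :
    E.correspondence.str.inner (edgeIndicator e) (edgeIndicator e) = vertexIndicator (E.r e) := by
  classical
  refine ZeroAtInftyContinuousMap.ext fun v => ?_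
  change ∑' f : E.Fiber v, starRingEnd ℂ ((Pi.single e 1 : E.Edge → ℂ) f)
    * (Pi.single e 1 : E.Edge → ℂ) f = _
  by_cases h : v = E.r e
  · subst h
    rw [vertexIndicator_self, tsum_eq_single ⟨e, rfl⟩ fun f hf => ?_]
    · simp
    · have : f.1 ≠ e := fun h => hf (Subtype.ext h)
      simp [this]
  · rw [vertexIndicator_of_ne h]
    refine (tsum_congr fun f => ?_).trans tsum_zero
    have : f.1 ≠ e := by rintro rfl; exact h f.2.symm
    simp [this]

theorem inner_edgeIndicator_of_ne {e f : E.Edge} (h : e ≠ f) :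
    E.correspondence.str.inner (edgeIndicator e) (edgeIndicator f) = 0 := by
  classical
  refine ZeroAtInftyContinuousMap.ext fun v => ?_
  change ∑' g : E.Fiber v, starRingEnd ℂ ((Pi.single e 1 : E.Edge → ℂ) g)
    * (Pi.single f 1 : E.Edge → ℂ) g = 0
  refine (tsum_congr fun g => ?_).trans tsum_zero
  by_cases hg : g.1 = e
  · have : g.1 ≠ f := hg ▸ h
    simp [this]
  · simp [hg]

/-- With finitely many edges every function on them has finite support. With infinitely many, `X(E)`
also has elements of infinite support, outside the algebraic span. -/
theorem span_edgeIndicator [Finite E.Edge] :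
    Submodule.span ℂ (Set.range (edgeIndicator (E := E))) = ⊤ := by
  classical
  have := Fintype.ofFinite E.Edge
  rw [eq_top_iff]
  rintro ξ -
  have h : ξ = ∑ e, (toX ξ).1 e • edgeIndicator e := by
    let L : E.moduleX →ₗ[ℂ] E.Edge → ℂ := E.moduleX.subtype
    refine Subtype.ext (Eq.trans ?_ (map_sum L _ _).symm)
    refine (pi_eq_sum_univ' (toX ξ).1).trans (Finset.sum_congr rfl fun e _ => ?_)
    funext f
    change (toX ξ).1 e * _ = (toX ξ).1 e * (Pi.single e 1 : E.Edge → ℂ) f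
    simp [Pi.single_apply, eq_comm]
  rw [h]
  exact Submodule.sum_mem _ fun e _ =>
    Submodule.smul_mem _ _ (Submodule.subset_span ⟨e, rfl⟩)

/-! ### Periodicity forces a simple cycle -/

/-- If `E` has no sinks, then every edge is the first edge of a path of length `n + 1`. The
indicators of such paths are orthogonal, nonzero elements of `X(E)^{⊗ (n + 1)}`. -/
theorem exists_path_vectors (hsinks : E.NoSinks) (n : ℕ) :
    ∃ x : E.Edge → (E.correspondence.tensorPower (n + 1)).carrier,
      (∀ a e, (E.correspondence.tensorPower (n + 1)).str.left a (x e) = a (E.s e) • x e) ∧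
      (∀ e, (E.correspondence.tensorPower (n + 1)).str.inner (x e) (x e) ≠ 0) ∧
      ∀ e f, e ≠ f → (E.correspondence.tensorPower (n + 1)).str.inner (x e) (x f) = 0 := by
  induction n with
  | zero =>
    exact ⟨edgeIndicator, left_edgeIndicator,
      fun e h => vertexIndicator_ne_zero _ ((inner_edgeIndicator_self e).symm.trans h),
      fun _ _ => inner_edgeIndicator_of_ne⟩
  | succ n ih =>
    obtain ⟨x, hleft, hne, -⟩ := ih
    -- `g e` is an edge that can follow `e`. The new vector prepends `e` to the path chosen for `g
    -- e`; orthogonality will come from the first factor alone.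
    choose g hg using fun e => hsinks (E.r e)
    refine ⟨fun e => tmul _ _ (edgeIndicator e) (x (g e)), fun a e => ?_, fun e => ?_,
      fun e f hef => ?_⟩
    · refine (left_tmul _ _ _ _ _).trans ?_
      rw [left_edgeIndicator, map_smul, LinearMap.smul_apply]
      rfl
    · refine (inner_tmul _ _ _ _ _ _).trans_ne ?_
      -- The indicator of `r e` acts as `1` because `g e` starts at `r e`, so the new inner product
      -- equals that of the shorter path.
      rw [inner_edgeIndicator_self, hleft, hg, vertexIndicator_self, one_smul]
      exact hne _
    · refine (inner_tmul _ _ _ _ _ _).trans ?_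
      rw [inner_edgeIndicator_of_ne hef]
      simp

/-- Preserving the left action confines the image of a path vector to the source of its first edge;
preserving the inner product keeps these images nonzero and orthogonal. Two nonzero functions
supported at one common vertex are never orthogonal. -/
theorem injective_source_of_isomorphic (hsinks : E.NoSinks) (n : ℕ)
    (h : Isomorphic (E.correspondence.tensorPower (n + 1)) (identity C₀(E.Vertex, ℂ))) :
    Function.Injective E.s := by
  obtain ⟨x, hleft, hne, horth⟩ := exists_path_vectors hsinks n
  obtain ⟨Φ, -, hΦleft, hΦinner⟩ := h
  let φ : E.Edge → C₀(E.Vertex, ℂ) := fun e => Φ (x e)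
  have hsupp : ∀ e v, v ≠ E.s e → φ e v = 0 := fun e v hv => by
    -- The vector `x e` is fixed by the indicator of its source, hence so is its image.
    have h1 : vertexIndicator (E.s e) * φ e = φ e := by
      have := hΦleft (vertexIndicator (E.s e)) (x e)
      rw [hleft, vertexIndicator_self, one_smul] at this
      exact this.symm
    rw [← h1, ZeroAtInftyContinuousMap.mul_apply, vertexIndicator_of_ne hv, zero_mul]
  have hinner : ∀ e f, star (φ e) * φ f
      = (E.correspondence.tensorPower (n + 1)).str.inner (x e) (x f) :=
    fun e f => hΦinner (x e) (x f)
  have hval : ∀ e, φ e (E.s e) ≠ 0 := fun e h0 => by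
    refine hne e ?_
    rw [← hinner]
    refine ZeroAtInftyContinuousMap.ext fun v => ?_
    have : φ e v = 0 := by
      by_cases hv : v = E.s e
      · rw [hv, h0]
      · exact hsupp e v hv
    simp [this]
  intro e f hef
  by_contra hne'
  have h1 := congrArg (fun a : C₀(E.Vertex, ℂ) => a (E.s e)) ((hinner e f).trans (horth e f hne'))
  have h2 : star (φ e (E.s e)) * φ f (E.s e) = 0 := h1
  rcases mul_eq_zero.1 h2 with h3 | h3
  · exact hval e (star_eq_zero.1 h3)
  · exact hval f (hef ▸ h3)

/-- Following the unique edge out of each vertex defines a permutation `σ`. A link between two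
vertices is one step of `σ` in one of the two directions, so weak connectedness says that `σ` has a
single orbit, and that orbit enumerates the cycle. -/
theorem isSimpleCycle_of_injective_source [Nonempty E.Vertex] [Finite E.Vertex]
    (hconn : E.WeaklyConnected) (hsinks : E.NoSinks) (hsources : E.NoSources)
    (hs : Function.Injective E.s) : E.IsSimpleCycle := by
  let S : E.Edge ≃ E.Vertex := Equiv.ofBijective E.s ⟨hs, hsinks⟩
  have hr : Function.Injective E.r := by
    have h : Function.Surjective (E.r ∘ S.symm) :=
      Function.Surjective.comp hsources S.symm.surjective
    have h' := Finite.injective_iff_surjective.2 h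
    exact (S.symm.injective_comp _).1 h'
  let R : E.Edge ≃ E.Vertex := Equiv.ofBijective E.r ⟨hr, hsources⟩
  let σ : Equiv.Perm E.Vertex := S.symm.trans R
  have hσ : ∀ e, σ (E.s e) = E.r e := fun e => congrArg R (S.symm_apply_apply e)
  obtain ⟨v₀⟩ := ‹Nonempty E.Vertex›
  have hsame : ∀ v, σ.SameCycle v₀ v := fun v => by
    induction hconn v₀ v with
    | refl => exact Equiv.Perm.SameCycle.refl _ _
    | tail _ h ih =>
      obtain ⟨e, ⟨rfl, rfl⟩ | ⟨rfl, rfl⟩⟩ := h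
      · rw [← hσ]
        exact Equiv.Perm.sameCycle_apply_right.2 ih
      · rw [← hσ] at ih
        exact Equiv.Perm.sameCycle_apply_right.1 ih
  -- The cycle length is the period of `v₀`, positive because an injective self-map of a finite set
  -- has only periodic points.
  obtain ⟨n, hn⟩ : ∃ n, Function.minimalPeriod σ v₀ = n + 1 :=
    Nat.exists_eq_succ_of_ne_zero (Function.minimalPeriod_pos_of_mem_periodicPts
      (Function.Injective.mem_periodicPts σ.injective v₀)).ne'
  have hmod : ∀ k, σ^[k % (n + 1)] v₀ = σ^[k] v₀ := fun k => by
    rw [← hn, Function.iterate_mod_minimalPeriod_eq]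
  have hinj : Function.Injective fun i : Fin (n + 1) => σ^[i] v₀ := fun i j hij =>
    Fin.ext (Function.iterate_injOn_Iio_minimalPeriod (f := σ) (x := v₀)
      (by simp [hn, i.2]) (by simp [hn, j.2]) hij)
  have hsurj : Function.Surjective fun i : Fin (n + 1) => σ^[i] v₀ := fun v => by
    -- By finiteness the integer power joining two points of a cycle can be taken natural; it is
    -- then reduced modulo the period.
    obtain ⟨k, -, hk⟩ := (hsame v).exists_pow_eq'
    refine ⟨⟨k % (n + 1), Nat.mod_lt _ n.succ_pos⟩, ?_⟩
    change σ^[k % (n + 1)] v₀ = v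
    rw [hmod, ← hk, Equiv.Perm.iterate_eq_pow]
  let V : Fin (n + 1) ≃ E.Vertex := Equiv.ofBijective _ ⟨hinj, hsurj⟩
  have hV : ∀ i, V (i + 1) = σ (V i) := fun i => by
    change σ^[(i + 1 : Fin (n + 1))] v₀ = σ (σ^[i] v₀)
    -- Addition in `Fin (n + 1)` wraps around at the last index, and `hmod` absorbs the wrap.
    have hi : ((i + 1 : Fin (n + 1)) : ℕ) = (i.1 + 1) % (n + 1) := by
      rw [Fin.val_add, Fin.val_one', Nat.add_mod_mod]
    rw [← Function.iterate_succ_apply' σ, hi, hmod]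
  refine ⟨n, V, V.trans S.symm, fun i => ?_⟩
  have h1 : E.s (S.symm (V i)) = V i := S.apply_symm_apply (V i)
  refine ⟨h1, ?_⟩
  rw [hV]
  exact (hσ _).symm.trans (congrArg σ h1)

/-! ### A simple cycle is periodic -/

/-- For a cycle, `X(E)^{⊗ (m + 1)}` has a basis indexed by the vertices, given by the paths of
length `m + 1`. -/
theorem exists_cycle_basis {n : ℕ} (v : Fin (n + 1) ≃ E.Vertex) (e : Fin (n + 1) ≃ E.Edge)
    (h : ∀ i, E.s (e i) = v i ∧ E.r (e i) = v (i + 1)) (m : ℕ) :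
    ∃ y : Fin (n + 1) → (E.correspondence.tensorPower (m + 1)).carrier,
      (∀ a i, (E.correspondence.tensorPower (m + 1)).str.left a (y i) = a (v i) • y i) ∧
      (∀ i, (E.correspondence.tensorPower (m + 1)).str.inner (y i) (y i)
        = vertexIndicator (v (i + (m + 1) • (1 : Fin (n + 1))))) ∧
      (∀ i j, i ≠ j → (E.correspondence.tensorPower (m + 1)).str.inner (y i) (y j) = 0) ∧
      Submodule.span ℂ (Set.range y) = ⊤ := by
  have : Finite E.Edge := Finite.of_equiv _ e
  have hspan : Submodule.span ℂ (Set.range fun i => edgeIndicator (e i)) = ⊤ := by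
    rw [← span_edgeIndicator]
    exact congrArg _ (e.surjective.range_comp edgeIndicator)
  have hleft₁ : ∀ a i, E.correspondence.str.left a (edgeIndicator (e i))
      = a (v i) • edgeIndicator (e i) := fun a i => by rw [left_edgeIndicator, (h i).1]
  have hself₁ : ∀ i, E.correspondence.str.inner (edgeIndicator (e i)) (edgeIndicator (e i))
      = vertexIndicator (v (i + 1)) := fun i => by rw [inner_edgeIndicator_self, (h i).2]
  have horth₁ : ∀ i j, i ≠ j →
      E.correspondence.str.inner (edgeIndicator (e i)) (edgeIndicator (e j)) = 0 :=
    fun i j hij => inner_edgeIndicator_of_ne (e.injective.ne hij)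
  induction m with
  | zero =>
    refine ⟨fun i => edgeIndicator (e i), hleft₁, fun i => ?_, horth₁, hspan⟩
    simpa using! hself₁ i
  | succ m ih =>
    obtain ⟨y, hleft, hself, horth, hy⟩ := ih
    -- The path of length `m + 2` from `v i` is the edge `e i` followed by the path of length `m +
    -- 1` from `v (i + 1)`.
    refine ⟨fun i => tmul _ _ (edgeIndicator (e i)) (y (i + 1)), fun a i => ?_, fun i => ?_,
      fun i j hij => ?_, ?_⟩
    · refine (left_tmul _ _ _ _ _).trans ?_
      rw [hleft₁, map_smul, LinearMap.smul_apply]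
      rfl
    · refine (inner_tmul _ _ _ _ _ _).trans ?_
      rw [hself₁, hleft, vertexIndicator_self, one_smul, hself]
      congr 2
      rw [succ_nsmul' _ (m + 1), add_assoc]
    · refine (inner_tmul _ _ _ _ _ _).trans ?_
      rw [horth₁ i j hij]
      simp
    -- All products of basis vectors span, and those with `j ≠ i + 1` vanish: the indicator of `v (i
    -- + 1)` kills a path starting at `v j`. Only the composable ones remain.
    · let T : Fin (n + 1) → Fin (n + 1) →
          (E.correspondence.tensor (E.correspondence.tensorPower (m + 1))).carrier :=
        fun i j => tmul _ _ (edgeIndicator (e i)) (y j)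
      have hle : Submodule.span ℂ (Set.range fun p : Fin (n + 1) × Fin (n + 1) => T p.1 p.2)
          ≤ Submodule.span ℂ (Set.range fun i => T i (i + 1)) := by
        rw [Submodule.span_le]
        rintro _ ⟨⟨i, j⟩, rfl⟩
        by_cases hij : j = i + 1
        · subst hij
          exact Submodule.subset_span ⟨i, rfl⟩
        · have h0 : T i j = 0 := by
            refine eq_zero_of_inner_self _ ((inner_tmul _ _ _ _ _ _).trans ?_)
            rw [hself₁, hleft, vertexIndicator_of_ne (v.injective.ne hij), zero_smul, map_zero]
          exact Set.mem_of_eq_of_mem h0 (Submodule.zero_mem _)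
      exact eq_top_iff.2 ((span_tmul_eq_top _ _ _ y hspan hy).symm.le.trans hle)

/-- After `n + 1` steps each path is back at its starting vertex, so the basis vectors have the left
action and the Gram matrix of the vertex indicators in `A`. -/
theorem isomorphic_identity_of_cycle {n : ℕ} (v : Fin (n + 1) ≃ E.Vertex)
    (e : Fin (n + 1) ≃ E.Edge) (h : ∀ i, E.s (e i) = v i ∧ E.r (e i) = v (i + 1)) :
    Isomorphic (E.correspondence.tensorPower (n + 1)) (identity C₀(E.Vertex, ℂ)) := by
  obtain ⟨y, hleft, hself, horth, hspan⟩ := exists_cycle_basis v e h n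
  have hcard : (n + 1) • (1 : Fin (n + 1)) = 0 := by
    simpa using! card_nsmul_eq_zero' (x := (1 : Fin (n + 1)))
  have hself' : ∀ i, (E.correspondence.tensorPower (n + 1)).str.inner (y i) (y i)
      = vertexIndicator (v i) := fun i => by rw [hself, hcard, add_zero]
  -- The map is built out of `A`, where coordinates are values at vertices; its inverse is the
  -- isomorphism sought.
  let Ψ : C₀(E.Vertex, ℂ) → (E.correspondence.tensorPower (n + 1)).carrier :=
    fun b => ∑ i, b (v i) • y i
  have hinner : ∀ b c, (E.correspondence.tensorPower (n + 1)).str.inner (Ψ b) (Ψ c)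
      = star b * c := fun b c => by
    have h1 : (E.correspondence.tensorPower (n + 1)).str.inner (Ψ b) (Ψ c)
        = ∑ i, (starRingEnd ℂ (b (v i)) * c (v i)) • vertexIndicator (v i) := by
      simp only [Ψ, map_sum, LinearMap.sum_apply, map_smulₛₗ, LinearMap.smul_apply,
        RingHom.id_apply]
      refine Finset.sum_congr rfl fun i _ => ?_
      rw [Finset.sum_eq_single i (fun j _ hj => ?_) (by simp), hself', smul_smul, mul_comm]
      simp [horth _ _ hj]
    rw [h1]
    refine ZeroAtInftyContinuousMap.ext fun w => ?_
    obtain ⟨i, rfl⟩ := v.surjective w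
    exact sum_smul_vertexIndicator_apply v _ i
  have hΨleft : ∀ a b, Ψ (a * b)
      = (E.correspondence.tensorPower (n + 1)).str.left a (Ψ b) := fun a b => by
    simp only [Ψ, map_sum, map_smul, hleft, smul_smul, ZeroAtInftyContinuousMap.mul_apply,
      mul_comm (b _)]
  have hsub : ∀ b c, Ψ (b - c) = Ψ b - Ψ c := fun b c => by
    simp [Ψ, sub_smul]
  -- Preservation of the inner product gives injectivity, since `star a * a = 0` forces `a = 0`.
  have hinj : Function.Injective Ψ := fun b c hbc => by
    have h1 := hinner (b - c) (b - c)
    rw [hsub, hbc, sub_self, map_zero] at h1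
    exact sub_eq_zero.1 ((CStarRing.star_mul_self_eq_zero_iff _).1 h1.symm)
  have hsurj : Function.Surjective Ψ := fun z => by
    obtain ⟨c, hc⟩ := Submodule.mem_span_range_iff_exists_fun ℂ |>.1
      (hspan ▸ Submodule.mem_top : z ∈ Submodule.span ℂ (Set.range y))
    refine ⟨∑ i, c i • vertexIndicator (v i), ?_⟩
    rw [← hc]
    refine Finset.sum_congr rfl fun i _ => ?_
    rw [sum_smul_vertexIndicator_apply]
  let Θ := Equiv.ofBijective Ψ ⟨hinj, hsurj⟩
  refine ⟨Θ.symm, Θ.symm.bijective, fun a x => ?_, fun x x' => ?_⟩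
  · obtain ⟨b, rfl⟩ := Θ.surjective x
    rw [Θ.symm_apply_apply]
    exact Θ.symm_apply_eq.2 (hΨleft a b).symm
  · obtain ⟨b, rfl⟩ := Θ.surjective x
    obtain ⟨c, rfl⟩ := Θ.surjective x'
    rw [Θ.symm_apply_apply, Θ.symm_apply_apply]
    exact (hinner b c).symm

end DirectedGraph

theorem mainTheorem8 (E : DirectedGraph) [Nonempty E.Vertex] [Finite E.Vertex]
    (hconn : E.WeaklyConnected) (hsinks : E.NoSinks) (hsources : E.NoSources) :
    E.correspondence.Nonperiodic ↔ ¬ E.IsSimpleCycle := by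
  refine ⟨?_, fun hE n hn => ?_⟩
  · rintro hX ⟨n, v, e, h⟩
    exact n.succ_ne_zero (hX _ (DirectedGraph.isomorphic_identity_of_cycle v e h))
  · cases n with
    | zero => rfl
    | succ n =>
      exact absurd (DirectedGraph.isSimpleCycle_of_injective_source hconn hsinks hsources
        (DirectedGraph.injective_source_of_isomorphic hsinks n hn)) hE
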